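/- Let $P$ be a finite set with at least two points, let $\mathsf d_1,\dots,\mathsf d_m$ ($m\ge 1$) be metrics on $P$, and let $\mathsf d=\max_i \mathsf d_i$ be the $\ell_\infty$-product metric. Let $\rho_i$ be the least integer such that every closed $\mathsf d_i$-ball of any radius $\rho$ is covered by at most $\rho_i$ closed $\mathsf d_i$-balls of radius $\rho/2$ (centered in $P$), let $\delta_i=\log_2\rho_i$ be the doubling dimension, and put $\delta=\sum_{i=1}^m\delta_i$. Let $\Delta$ be the spread of $(P,\mathsf d)$, that is, the ratio of the largest to the smallest $\mathsf d$-distance between distinct points; it is at most the maximum of the spreads of the $\mathsf d_i$. *Greedy tree.* Fix constants $\alpha>1$, $\beta\ge1$. Let $p_0,\dots,p_n$ be an enumeration of $P$, $P_i=\{p_0,\dots,p_{i-1}\}$, in which each $p_i$ with $i>0$ has a predecessor $T(p_i)\in P_i$, such that for all $i>0$: (i) $\mathsf d(p_j,P_i)\le\beta\,\mathsf d(p_i,P_i)$ for all $j\ge i$; (ii) $\mathsf d(p_i,T(p_i))\le\beta\,\mathsf d(p_i,P_i)$; (iii) $\alpha\,\mathsf d(p_i,T(p_i))\le \mathsf d(T(p_i),T(T(p_i)))$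 whenever $T(p_i)\ne p_0$. The greedy tree is the binary tree obtained from the single leaf $p_0$ by splitting, for $i=1,\dots,n$, the leaf $T(p_i)$ into a left child with the same center and a right child with center $p_i$. Each node $v$ has a center (also denoted $v$), the set $\mathrm{points}(v)$ of the leaves below it, and the radius $\mathrm{rad}(v)=\max_{x\in \mathrm{points}(v)}\mathsf d(v,x)$. *Query $(q,r_1,\dots,r_m,\varepsilon)$,* where $q\in P$, $r_i>0$, $\varepsilon>0$. Start with a max-heap $H$ (keyed by radius) that contains the root. While $H$ is nonempty and its maximum radius exceeds $\varepsilon r_i$ for some $i$: remove a node $v$ of maximum radius $r$; if $\mathsf d_i(q,v)\le(1+\varepsilon)r_i-r$ for all $i$, add $\mathrm{points}(v)$ to the output; otherwise, if $v$ is not a leaf, insert into $H$ each of its children $u$ that satisfies $\mathsf d_i(q,u)\le r_i+\mathrm{rad}(u)$ for all $i$. At the end add $\mathrm{points}(v)$ to the output for all $v\in H$. *Running time.* Evaluating some $\mathsf d_i$, comparing two reals, reading a stored radius and visiting a tree node while reporting points cost one unit each; an operation on a heap with $s$ nodes costs $1+\lfloor\log_2 s\rfloor$. **Theorem.** For all $\alpha>1$,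 $\beta\ge1$ there is a constant $C>0$, depending only on $\alpha$ and $\beta$, such that for all $P$, $\mathsf d_1,\dots,\mathsf d_m$, every greedy tree on $(P,\mathsf d)$ as above and every query $(q,r_1,\dots,r_m,\varepsilon)$, the query halts, however ties in the heap are broken, and takes time at most $$2^{C\delta}\Bigl(1+\frac A\varepsilon\Bigr)^{C\delta}\,(1+\log_2\Delta)+C\,k,$$ where $A=\max_i r_i/\min_i r_i$ and $k$ is the number of points in the output. -/

import Mathlib

namespace ProductRange

/-! ### Metrics, doubling dimension, spread -/

/-- The `ℓ_∞`-product metric of finitely many metrics on the same set of points. -/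
noncomputable def prodDist {P : Type*} {m : ℕ} (D : Fin m → MetricSpace P) (x y : P) : ℝ :=
  ⨆ i, (D i).dist x y

/-- The least `N` such that every closed ball of radius `ρ` is covered by at most `N` closed balls
of radius `ρ / 2` (with centers in `P`). -/
noncomputable def doublingConst {P : Type*} (d : P → P → ℝ) : ℕ :=
  sInf {N : ℕ | ∀ (x : P) (ρ : ℝ), ∃ S : Finset P, S.card ≤ N ∧
    ∀ y, d x y ≤ ρ → ∃ s ∈ S, d s y ≤ ρ / 2}

/-- The doubling dimension. -/
noncomputable def doublingDim {P : Type*} (d : P → P → ℝ) : ℝ :=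
  Real.logb 2 (doublingConst d)

/-- The ratio of the largest to the smallest distance between distinct points. -/
noncomputable def spread {P : Type*} (d : P → P → ℝ) : ℝ :=
  (⨆ z : {z : P × P // z.1 ≠ z.2}, d z.1.1 z.1.2) /
    (⨅ z : {z : P × P // z.1 ≠ z.2}, d z.1.1 z.1.2)

/-! ### Ball trees -/

/-- A binary tree in which every node has a center and the leaves are single points. -/
inductive BallTree (P : Type*) where
  | leaf (c : P) : BallTree P
  | node (c : P) (left right : BallTree P) : BallTree P

namespace BallTree

variable {P : Type*}

def center : BallTree P → P
  | leaf c => c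
  | node c _ _ => c

/-- The points stored in the leaves below a node. -/
def points [DecidableEq P] : BallTree P → Finset P
  | leaf c => {c}
  | node _ l r => l.points ∪ r.points

/-- The number of tree nodes below (and including) a node: the cost of enumerating its points. -/
def numNodes : BallTree P → ℕ
  | leaf _ => 1
  | node _ l r => 1 + l.numNodes + r.numNodes

/-- The radius of a node: the largest distance from its center to one of its points. -/
noncomputable def radius [DecidableEq P] (d : P → P → ℝ) (v : BallTree P) : ℝ :=
  ⨆ x : {x // x ∈ v.points}, d v.center x

/-- Split the leaf `a`: its left child is again centered at `a`, its right child at `b`. -/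
def splitLeaf [DecidableEq P] (a b : P) : BallTree P → BallTree P
  | leaf c => if c = a then node a (leaf a) (leaf b) else leaf c
  | node c l r => node c (l.splitLeaf a b) (r.splitLeaf a b)

end BallTree

/-! ### Greedy trees -/

/-- An enumeration `p_0, …, p_n` of all the points, in which every point but the first has a
predecessor among the earlier points. (The value `pred 0` is not used.) -/
structure PredPairing (P : Type*) (n : ℕ) where
  order : Fin (n + 1) ≃ P
  pred : Fin (n + 1) → Fin (n + 1)
  pred_lt : ∀ i, i ≠ 0 → pred i < i

namespace PredPairing

variable {P : Type*} {n : ℕ}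

/-- The ball tree of the enumeration: start with the leaf `p_0`; then, for `i = 1, …, n`, split the
leaf at the predecessor of `p_i` into a left child with the same center and a right child `p_i`. -/
def tree [DecidableEq P] (G : PredPairing P n) : BallTree P :=
  Fin.foldl n (fun t i => t.splitLeaf (G.order (G.pred i.succ)) (G.order i.succ))
    (BallTree.leaf (G.order 0))

/-- The distance from `x` to the prefix `p_0, …, p_{i-1}`; used for `i ≠ 0` only. -/
noncomputable def prefixDist (G : PredPairing P n) (d : P → P → ℝ) (i : Fin (n + 1)) (x : P) : ℝ :=
  ⨅ k : {k : Fin (n + 1) // k < i}, d x (G.order k)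

/-- `G` is a (`β`-approximate, `α`-scaled) greedy permutation with predecessors:
* `greedy`: each point is, up to the factor `β`, a farthest one from the preceding prefix
  (`β = 1`: a greedy permutation);
* `near`: its predecessor is, up to the factor `β`, a nearest point of that prefix;
* `scaled`: its distance to its predecessor is smaller by a factor `α` than the distance of the
  predecessor to its own predecessor (which counts as infinite for the first point). -/
structure IsGreedy (G : PredPairing P n) (d : P → P → ℝ) (α β : ℝ) : Prop where
  greedy : ∀ i, i ≠ 0 → ∀ j, i ≤ j →
    G.prefixDist d i (G.order j) ≤ β * G.prefixDist d i (G.order i)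
  near : ∀ i, i ≠ 0 →
    d (G.order i) (G.order (G.pred i)) ≤ β * G.prefixDist d i (G.order i)
  scaled : ∀ i, i ≠ 0 → G.pred i ≠ 0 →
    α * d (G.order i) (G.order (G.pred i)) ≤
      d (G.order (G.pred i)) (G.order (G.pred (G.pred i)))

end PredPairing

/-! ### The query algorithm, with its running time -/

/-- A configuration of a query: the heap, the points reported so far, and the time spent. -/
inductive Config (P : Type*) where
  | running (heap : Multiset (BallTree P)) (output : Finset P) (time : ℕ) : Config P
  | done (output : Finset P) (time : ℕ) : Config P

/-- The time of an insertion into, or an extraction of the maximum from, a heap whose number of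
elements (counted with the element concerned) is `s`. -/
def heapTime (s : ℕ) : ℕ := 1 + Nat.log 2 s

section Query

variable {P : Type*} [DecidableEq P] {m : ℕ}

/-- The child `v` is inserted into the heap if `d_i(q, v) ≤ r_i + rad v` for all `i`. -/
noncomputable def keep (D : Fin m → MetricSpace P) (q : P) (r : Fin m → ℝ) (v : BallTree P) :
    Multiset (BallTree P) :=
  open Classical in
  if ∀ i, (D i).dist q v.center ≤ r i + v.radius (prodDist D) then {v} else 0

/-- One round of the query `(q, r_1, …, r_m, ε)`. Ties between nodes of maximum radius are broken
arbitrarily. The radii of the nodes are stored in the tree. Costs per round: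
`m + 1` for reading the maximum radius and comparing it with all `ε r_i`;
`heapTime` for each heap operation (`|H| + 2` bounds the heap size at the insertions);
`2 m` for each test of a node against the query (`m` distances and `m` comparisons);
`numNodes` for reporting the points of a node. -/
inductive Step (D : Fin m → MetricSpace P) (q : P) (r : Fin m → ℝ) (ε : ℝ) :
    Config P → Config P → Prop
  | accept (H : Multiset (BallTree P)) (out : Finset P) (t : ℕ) (v : BallTree P)
      (hmax : ∀ u ∈ H, u.radius (prodDist D) ≤ v.radius (prodDist D))
      (hloop : ∃ i, ε * r i < v.radius (prodDist D))
      (hin : ∀ i, (D i).dist q v.center ≤ (1 + ε) * r i - v.radius (prodDist D)) :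
      Step D q r ε (.running (v ::ₘ H) out t)
        (.running H (out ∪ v.points)
          (t + ((m + 1) + heapTime (H.card + 1) + 2 * m + v.numNodes)))
  | discard (H : Multiset (BallTree P)) (out : Finset P) (t : ℕ) (c : P)
      (hmax : ∀ u ∈ H, u.radius (prodDist D) ≤ (BallTree.leaf c).radius (prodDist D))
      (hloop : ∃ i, ε * r i < (BallTree.leaf c).radius (prodDist D))
      (hin : ¬ ∀ i, (D i).dist q c ≤ (1 + ε) * r i - (BallTree.leaf c).radius (prodDist D)) :
      Step D q r ε (.running (BallTree.leaf c ::ₘ H) out t)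
        (.running H out (t + ((m + 1) + heapTime (H.card + 1) + 2 * m)))
  | split (H : Multiset (BallTree P)) (out : Finset P) (t : ℕ) (c : P) (vL vR : BallTree P)
      (hmax : ∀ u ∈ H, u.radius (prodDist D) ≤ (BallTree.node c vL vR).radius (prodDist D))
      (hloop : ∃ i, ε * r i < (BallTree.node c vL vR).radius (prodDist D))
      (hin : ¬ ∀ i, (D i).dist q c ≤
        (1 + ε) * r i - (BallTree.node c vL vR).radius (prodDist D)) :
      Step D q r ε (.running (BallTree.node c vL vR ::ₘ H) out t)
        (.running (keep D q r vR + keep D q r vL + H) out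
          (t + ((m + 1) + heapTime (H.card + 1) + 2 * m +
            (2 * m + 2 * m + 2 * heapTime (H.card + 2)))))
  | finish (H : Multiset (BallTree P)) (out : Finset P) (t : ℕ)
      (hloop : ∀ v ∈ H, ∀ i, v.radius (prodDist D) ≤ ε * r i) :
      Step D q r ε (.running H out t)
        (.done (out ∪ (H.map BallTree.points).sup)
          (t + ((m + 1) + (H.map BallTree.numNodes).sum)))

/-- The query on the tree `T` halts, whichever way ties are broken, and every complete execution
with output `out` takes time at most `B out`. -/
def QueryTakes (D : Fin m → MetricSpace P) (T : BallTree P) (q : P) (r : Fin m → ℝ) (ε : ℝ)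
    (B : Finset P → ℝ) : Prop :=
  Acc (fun c' c => Step D q r ε c c') (.running {T} ∅ 1) ∧
  ∀ c, Relation.ReflTransGen (Step D q r ε) (.running {T} ∅ 1) c → (∀ c', ¬ Step D q r ε c c') →
    ∃ (out : Finset P) (t : ℕ), c = .done out t ∧ (t : ℝ) ≤ B out

end Query

end ProductRange

/-! Everything reduces to packing. A set that lies in a product of `D i`-balls of radius `R` and is
separated in the product metric has at most `(∏ i, doublingConst (D i).dist) ^ k` points once `2 ^
k` exceeds `2 * R` over the separation (`card_le_of_separated`). At a scale `ρ` above some `ε * r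
i`, every `r i` is at most `(A / ε) * ρ`, so sets of centers near `q` with separation proportional
to `ρ` have size at most some `N`, where `N ≤ (c * (1 + A / ε)) ^ δ` and `c` depends only on `α` and
`β` (`card_le_of_separated_of_query`).

Separation comes from the greedy order. Insertion distances decrease up to the factor `β`, so points
inserted no later than index `i` are at distance at least the `i`-th insertion distance divided by
`β`. The scaling condition makes distances along predecessor chains sum like a geometric series, so
the radius of an inner node is at most `B` times the insertion distance of its right child
(`IsNetTree.splitLeaf`).

This is used twice. Nodes that the query may process are counted by the centers of their right
children: at most `N` for each dyadic range of radii, and `1 + log₂ Δ` ranges suffice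
(`card_visited_le`). The heap always holds at most `N` nodes while the loop runs, because its
centers were inserted before the scale of the current maximum radius was passed
(`QueryInv.card_heap_le`). Hence a round costs `O(m + N)` besides reporting, which is charged to the
output. Since `m < N`, the total is `O(N ^ 2 * (1 + log₂ Δ) + k)`, and squaring `N` only changes the
constant in the exponent. -/

namespace ProductRange

/-! ### Packing in the product metric. -/

section Metric

variable {P : Type*} {m : ℕ} (D : Fin m → MetricSpace P)

lemma dist_le_prodDist (i : Fin m) (x y : P) : (D i).dist x y ≤ prodDist D x y :=
  le_ciSup (f := fun i => (D i).dist x y) (Set.finite_range _).bddAbove i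

lemma prodDist_le (hm : 0 < m) {x y : P} {c : ℝ} (h : ∀ i, (D i).dist x y ≤ c) :
    prodDist D x y ≤ c :=
  have : Nonempty (Fin m) := ⟨⟨0, hm⟩⟩
  ciSup_le h

lemma prodDist_self (x : P) : prodDist D x x = 0 := by
  simp [prodDist]

lemma prodDist_comm (x y : P) : prodDist D x y = prodDist D y x := by
  simp only [prodDist, fun i => (D i).dist_comm x y]

lemma prodDist_nonneg (x y : P) : 0 ≤ prodDist D x y :=
  Real.iSup_nonneg fun i => @dist_nonneg _ (D i).toPseudoMetricSpace x y

lemma prodDist_triangle (x y z : P) : prodDist D x z ≤ prodDist D x y + prodDist D y z :=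
  Real.iSup_le (fun i => ((D i).dist_triangle x y z).trans
    (add_le_add (dist_le_prodDist D i x y) (dist_le_prodDist D i y z)))
    (add_nonneg (prodDist_nonneg D _ _) (prodDist_nonneg D _ _))

lemma prodDist_pos (hm : 0 < m) {x y : P} (h : x ≠ y) : 0 < prodDist D x y :=
  ((@dist_pos _ (D ⟨0, hm⟩) x y).2 h).trans_le (dist_le_prodDist D ⟨0, hm⟩ x y)

/-- Finiteness of `P` makes the set in the definition nonempty (take all points as centers), so the
infimum is attained. -/
lemma doublingConst_spec [Finite P] (M : MetricSpace P) (x : P) (ρ : ℝ) :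
    ∃ S : Finset P, S.card ≤ doublingConst M.dist ∧
      ∀ y, M.dist x y ≤ ρ → ∃ s ∈ S, M.dist s y ≤ ρ / 2 := by
  have := Fintype.ofFinite P
  refine Nat.sInf_mem (s := {N : ℕ | ∀ (x : P) (ρ : ℝ), ∃ S : Finset P, S.card ≤ N ∧
    ∀ y, M.dist x y ≤ ρ → ∃ s ∈ S, M.dist s y ≤ ρ / 2})
    ⟨Fintype.card P, fun x ρ => ⟨Finset.univ, le_rfl, fun y hy => ⟨y, Finset.mem_univ _, ?_⟩⟩⟩ x ρ
  have h0 : 0 ≤ M.dist x y := @dist_nonneg _ M.toPseudoMetricSpace x y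
  rw [M.dist_self]
  linarith

/-- For a closest pair `x`, `y`, the ball of radius `d(x, y)` about `x` contains both, while balls
of half that radius are singletons. -/
lemma two_le_doublingConst [Finite P] [Nontrivial P] (M : MetricSpace P) :
    2 ≤ doublingConst M.dist := by
  obtain ⟨a, b, hab⟩ := exists_pair_ne P
  have : Nonempty {z : P × P // z.1 ≠ z.2} := ⟨⟨(a, b), hab⟩⟩
  obtain ⟨⟨⟨x, y⟩, hxy⟩, hmin⟩ :=
    Finite.exists_min (fun z : {z : P × P // z.1 ≠ z.2} => M.dist z.1.1 z.1.2)
  have hpos : 0 < M.dist x y := (@dist_pos _ M x y).2 hxy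
  have key : ∀ s z, M.dist s z ≤ M.dist x y / 2 → s = z := by
    intro s z h
    by_contra hne
    have := hmin ⟨(s, z), hne⟩
    simp only at this
    linarith
  obtain ⟨S, hS, hcov⟩ := doublingConst_spec M x (M.dist x y)
  obtain ⟨s, hs, hsx⟩ := hcov x (by rw [M.dist_self]; exact hpos.le)
  obtain ⟨t, ht, hty⟩ := hcov y le_rfl
  have h1 := key _ _ hsx
  have h2 := key _ _ hty
  subst h1 h2
  exact (Finset.one_lt_card.2 ⟨_, hs, _, ht, hxy⟩).trans_le hS

lemma exists_cover_pow [Finite P] (M : MetricSpace P) (x : P) (ρ : ℝ) (k : ℕ) :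
    ∃ S : Finset P, S.card ≤ doublingConst M.dist ^ k ∧
      ∀ y, M.dist x y ≤ ρ → ∃ s ∈ S, M.dist s y ≤ ρ / 2 ^ k := by
  classical
  induction k with
  | zero => exact ⟨{x}, by simp, fun y hy => ⟨x, by simp, by simpa using hy⟩⟩
  | succ k ih =>
    obtain ⟨S, hS, hcov⟩ := ih
    choose F hF hFcov using fun s => doublingConst_spec M s (ρ / 2 ^ k)
    refine ⟨S.biUnion F, ?_, fun y hy => ?_⟩
    · rw [pow_succ]
      exact (Finset.card_biUnion_le_card_mul S F _ fun s _ => hF s).trans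
        (Nat.mul_le_mul_right _ hS)
    · obtain ⟨s, hs, hsy⟩ := hcov y hy
      obtain ⟨t, ht, hty⟩ := hFcov s y hsy
      exact ⟨t, Finset.mem_biUnion.2 ⟨s, hs, ht⟩, by rwa [pow_succ, ← div_div]⟩

/-- A set that is separated in the product metric and lies in a product of balls is small. -/
lemma card_le_of_separated [Finite P] (hm : 0 < m) (q : P) (R s : ℝ) (k : ℕ) (S : Finset P)
    (hball : ∀ x ∈ S, ∀ i, (D i).dist q x ≤ R)
    (hsep : ∀ x ∈ S, ∀ y ∈ S, x ≠ y → s ≤ prodDist D x y) (hk : 2 * R / 2 ^ k < s) :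
    S.card ≤ (∏ i, doublingConst (D i).dist) ^ k := by
  classical
  choose F hF hcov using fun i => exists_cover_pow (D i) q R k
  have hex : ∀ x : P, ∀ i, ∃ s, x ∈ S → s ∈ F i ∧ (D i).dist s x ≤ R / 2 ^ k := by
    intro x i
    by_cases hx : x ∈ S
    · obtain ⟨s, hs, hsx⟩ := hcov i x (hball x hx i)
      exact ⟨s, fun _ => ⟨hs, hsx⟩⟩
    · exact ⟨x, fun h => absurd h hx⟩
  choose f hf using hex
  -- Two points sharing their cover centers in every factor are within `2 * R / 2 ^ k` in every `D
  -- i`, hence in the product metric.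
  have hinj : Set.InjOn f S := by
    intro x hx y hy hxy
    by_contra hne
    have h1 : prodDist D x y ≤ 2 * R / 2 ^ k := by
      refine prodDist_le D hm fun i => ?_
      have h2 := (hf x i hx).2
      have h3 := (hf y i hy).2
      rw [← hxy] at h3
      have h4 := (D i).dist_triangle x (f x i) y
      rw [(D i).dist_comm x (f x i)] at h4
      have : 2 * R / 2 ^ k = R / 2 ^ k + R / 2 ^ k := by ring
      linarith
    exact absurd (hsep x hx y hy hne) (by linarith)
  calc S.card ≤ (Fintype.piFinset F).card :=
        Finset.card_le_card_of_injOn f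
          (fun x hx => Fintype.mem_piFinset.2 fun i => (hf x i hx).1) hinj
    _ = ∏ i, (F i).card := Fintype.card_piFinset F
    _ ≤ ∏ i, doublingConst (D i).dist ^ k := Finset.prod_le_prod' fun i _ => hF i
    _ = _ := Finset.prod_pow _ _ _

lemma prod_doublingConst [Finite P] [Nontrivial P] :
    ((∏ i, doublingConst (D i).dist : ℕ) : ℝ) = 2 ^ ∑ i, doublingDim (D i).dist := by
  rw [Real.rpow_sum_of_pos two_pos, Nat.cast_prod]
  refine Finset.prod_congr rfl fun i _ => ?_
  have := two_le_doublingConst (D i)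
  rw [doublingDim, Real.rpow_logb two_pos (by norm_num)]
  exact_mod_cast (by omega : 0 < doublingConst (D i).dist)

lemma two_pow_le_prod_doublingConst [Finite P] [Nontrivial P] :
    2 ^ m ≤ ∏ i, doublingConst (D i).dist := by
  calc 2 ^ m = ∏ _i : Fin m, 2 := by simp
    _ ≤ _ := Finset.prod_le_prod' fun i _ => two_le_doublingConst (D i)

end Metric

/-! ### Radii and points of ball trees. -/

namespace BallTree

variable {P : Type*} [DecidableEq P]

lemma dist_le_radius (d : P → P → ℝ) (v : BallTree P) {x : P} (hx : x ∈ v.points) :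
    d v.center x ≤ v.radius d :=
  le_ciSup (f := fun x : {x // x ∈ v.points} => d v.center x) (Set.finite_range _).bddAbove ⟨x, hx⟩

lemma radius_le (d : P → P → ℝ) (v : BallTree P) {c : ℝ} (h0 : 0 ≤ c)
    (h : ∀ x ∈ v.points, d v.center x ≤ c) : v.radius d ≤ c :=
  Real.iSup_le (fun x => h x x.2) h0

@[simp] lemma center_splitLeaf (a b : P) (t : BallTree P) :
    (t.splitLeaf a b).center = t.center := by
  cases t with
  | leaf c =>
    by_cases h : c = a
    · simp [splitLeaf, h, center]
    · simp [splitLeaf, h]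
  | node c l r => rfl

lemma points_splitLeaf (a b : P) (t : BallTree P) :
    (t.splitLeaf a b).points = if a ∈ t.points then insert b t.points else t.points := by
  induction t with
  | leaf c =>
    by_cases h : c = a
    · subst h; ext x; simp [splitLeaf, points, or_comm]
    · simp [splitLeaf, h, points, Ne.symm h]
  | node c l r hl hr =>
    ext x
    simp only [splitLeaf, points, hl, hr, Finset.mem_union]
    by_cases h1 : a ∈ l.points <;> by_cases h2 : a ∈ r.points <;> simp [h1, h2] <;> tauto

lemma mem_points_splitLeaf {a b x : P} {t : BallTree P} (h : x ∈ (t.splitLeaf a b).points) :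
    x ∈ t.points ∨ x = b ∧ a ∈ t.points := by
  rw [points_splitLeaf] at h
  split_ifs at h with ha
  · exact (Finset.mem_insert.1 h).symm.imp_right fun h => ⟨h, ha⟩
  · exact Or.inl h

end BallTree

lemma foldl_induction {A : Type*} {n : ℕ} (p : ℕ → A → Prop) (f : A → Fin n → A) (a : A)
    (h0 : p 0 a) (hs : ∀ (i : Fin n) a, p i a → p (i + 1) (f a i)) : p n (Fin.foldl n f a) := by
  induction n with
  | zero => simpa using h0
  | succ n ih =>
    rw [Fin.foldl_succ_last]
    exact hs (Fin.last n) _ (ih _ fun i a h => hs i.castSucc a h)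

/-! ### Greedy trees: node radii against insertion distances. -/

namespace PredPairing

variable {P : Type*} {n : ℕ} (G : PredPairing P n) {d : P → P → ℝ} {α β : ℝ}

lemma prefixDist_le {i k : Fin (n + 1)} (h : k < i) (x : P) :
    G.prefixDist d i x ≤ d x (G.order k) :=
  ciInf_le (f := fun k : {k : Fin (n + 1) // k < i} => d x (G.order k))
    (Set.finite_range _).bddBelow ⟨k, h⟩

lemma prefixDist_anti {i j : Fin (n + 1)} (hi : i ≠ 0) (hij : i ≤ j) (x : P) :
    G.prefixDist d j x ≤ G.prefixDist d i x :=
  have : Nonempty {k : Fin (n + 1) // k < i} := ⟨⟨0, Fin.pos_of_ne_zero hi⟩⟩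
  le_ciInf fun k => G.prefixDist_le (k.2.trans_le hij) x

/-- The insertion distance of the `i`-th point. -/
noncomputable def insDist (d : P → P → ℝ) (i : Fin (n + 1)) : ℝ := G.prefixDist d i (G.order i)

lemma insDist_nonneg (hd : ∀ x y, 0 ≤ d x y) (i : Fin (n + 1)) : 0 ≤ G.insDist d i :=
  Real.iInf_nonneg fun _ => hd _ _

variable {G}

/-- Enlarging the prefix only decreases the distance to it; the greedy condition then compares at
stage `k`. -/
lemma IsGreedy.insDist_le_mul (hG : G.IsGreedy d α β) {i k : Fin (n + 1)} (hk : k ≠ 0)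
    (hki : k ≤ i) : G.insDist d i ≤ β * G.insDist d k :=
  (G.prefixDist_anti hk hki _).trans (hG.greedy k hk i hki)

lemma IsGreedy.insDist_le_mul_dist (hG : G.IsGreedy d α β) (hβ : 0 ≤ β) {i j k : Fin (n + 1)}
    (hjk : j < k) (hki : k ≤ i) : G.insDist d i ≤ β * d (G.order k) (G.order j) :=
  (hG.insDist_le_mul (Fin.ne_zero_of_lt hjk) hki).trans
    (mul_le_mul_of_nonneg_left (G.prefixDist_le hjk _) hβ)

variable (G) [DecidableEq P]

/-- A ball tree in which left children inherit the center, siblings are disjoint, and the points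
below an inner node are close to its center on the scale at which the right child was inserted. -/
def IsNetTree (d : P → P → ℝ) (B γ : ℝ) : BallTree P → Prop
  | .leaf _ => True
  | .node c l r => l.center = c ∧ Disjoint l.points r.points ∧
      G.order.symm c < G.order.symm r.center ∧
      (∀ x ∈ l.points ∪ r.points, x = c ∨ G.order.symm r.center ≤ G.order.symm x ∧
        d c x + γ * d x (G.order (G.pred (G.order.symm x))) ≤
          B * G.insDist d (G.order.symm r.center)) ∧
      IsNetTree d B γ l ∧ IsNetTree d B γ r

variable {G}

lemma IsNetTree.center_mem {B γ : ℝ} {v : BallTree P} (h : G.IsNetTree d B γ v) :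
    v.center ∈ v.points := by
  induction v with
  | leaf c => simp [BallTree.center, BallTree.points]
  | node c l r hl hr =>
    obtain ⟨h1, -, -, -, h2, -⟩ := h
    simpa [BallTree.center, BallTree.points, ← h1] using Or.inl (hl h2)

/-- Charges the cost of reporting a node to the points reported; disjointness of siblings makes
leaves and points correspond. -/
lemma IsNetTree.numNodes_succ {B γ : ℝ} {v : BallTree P} (h : G.IsNetTree d B γ v) :
    v.numNodes + 1 = 2 * v.points.card := by
  induction v with
  | leaf c => simp [BallTree.numNodes, BallTree.points]
  | node c l r hl hr =>
    obtain ⟨-, h1, -, -, h2, h3⟩ := h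
    have := hl h2
    have := hr h3
    simp only [BallTree.numNodes, BallTree.points, Finset.card_union_of_disjoint h1]
    omega

/-- The term `γ * d x (pred x)` reserves room for all later descendants of `x`. With `γ = 1 / (α -
1)` one has `α * γ = 1 + γ`, so when a new point `p` is attached to `x`, the reserve of `x` pays
both for the step from `x` to `p` and for the reserve of `p`. At the center itself there is no
reserve to draw on, and the bound comes from `near` and `greedy`, at the price of one factor `β`
each. -/
lemma IsNetTree.splitLeaf (hG : G.IsGreedy d α β) (hα : 1 < α) (hβ : 1 ≤ β)
    (hcomm : ∀ x y, d x y = d y x)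
    (htri : ∀ x y z, d x z ≤ d x y + d y z)
    {i : Fin (n + 1)} (hi : i ≠ 0) {t : BallTree P}
    (ht : G.IsNetTree d (β ^ 2 * (1 + 1 / (α - 1))) (1 / (α - 1)) t)
    (hlt : ∀ x ∈ t.points, G.order.symm x < i) :
    G.IsNetTree d (β ^ 2 * (1 + 1 / (α - 1))) (1 / (α - 1))
      (t.splitLeaf (G.order (G.pred i)) (G.order i)) := by
  have hγ : 0 < 1 / (α - 1) := one_div_pos.2 (by linarith)
  have hαγ : α * (1 / (α - 1)) = 1 + 1 / (α - 1) := by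
    have : α - 1 ≠ 0 := by linarith
    field_simp
    ring
  set γ := 1 / (α - 1) with hγdef
  have hnew : ∀ j : Fin (n + 1), j ≠ 0 → j ≤ i →
      d (G.order i) (G.order (G.pred i)) ≤ β ^ 2 * G.insDist d j := by
    intro j hj hji
    have h1 := hG.near i hi
    have h2 := hG.insDist_le_mul hj hji
    have h3 : β * G.insDist d i ≤ β * (β * G.insDist d j) :=
      mul_le_mul_of_nonneg_left h2 (by linarith)
    calc _ ≤ _ := h1
      _ ≤ _ := h3
      _ = _ := by ring
  have hnew' : ∀ j : Fin (n + 1), j ≠ 0 → j ≤ i →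
      d (G.order (G.pred i)) (G.order i) + γ * d (G.order i) (G.order (G.pred i)) ≤
        β ^ 2 * (1 + γ) * G.insDist d j := by
    intro j hj hji
    rw [hcomm (G.order (G.pred i))]
    have := mul_le_mul_of_nonneg_left (hnew j hj hji) (by linarith : 0 ≤ 1 + γ)
    linarith
  induction t with
  | leaf c =>
    by_cases h : c = G.order (G.pred i)
    · subst h
      have hlt := G.pred_lt i hi
      simp only [BallTree.splitLeaf, if_true, IsNetTree, BallTree.center, BallTree.points]
      refine ⟨trivial, by simpa using hlt.ne, by simpa using hlt, ?_, trivial, trivial⟩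
      intro x hx
      simp only [Finset.mem_union, Finset.mem_singleton] at hx
      refine hx.imp_right ?_
      rintro rfl
      exact ⟨le_rfl, by simpa using hnew' i hi le_rfl⟩
    · simp [BallTree.splitLeaf, h, IsNetTree]
  | node c l r hl hr =>
    obtain ⟨h1, h2, h3, h4, h5, h6⟩ := ht
    have hil : G.order i ∉ l.points := fun h => by simpa using hlt _ (Finset.mem_union_left _ h)
    have hir : G.order i ∉ r.points := fun h => by simpa using hlt _ (Finset.mem_union_right _ h)
    refine ⟨by simpa using h1, ?_, by simpa using h3, ?_,
      hl (fun x hx => hlt x (Finset.mem_union_left _ hx)) h5,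
      hr (fun x hx => hlt x (Finset.mem_union_right _ hx)) h6⟩
    · rw [BallTree.points_splitLeaf, BallTree.points_splitLeaf]
      split_ifs with ha hb hb
      · exact absurd hb (Finset.disjoint_left.1 h2 ha)
      · exact Finset.disjoint_insert_left.2 ⟨hir, h2⟩
      · exact Finset.disjoint_insert_right.2 ⟨hil, h2⟩
      · exact h2
    · intro x hx
      have hx' : x ∈ l.points ∪ r.points ∨
          x = G.order i ∧ G.order (G.pred i) ∈ l.points ∪ r.points :=
        BallTree.mem_points_splitLeaf (t := .node c l r) hx
      rw [BallTree.center_splitLeaf]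
      obtain hx' | ⟨rfl, ha⟩ := hx'
      · exact h4 x hx'
      · right
        have hr0 : G.order.symm r.center ≠ 0 := Fin.ne_zero_of_lt h3
        have hri : G.order.symm r.center ≤ i :=
          (hlt r.center (Finset.mem_union_right _ h6.center_mem)).le
        rw [Equiv.symm_apply_apply]
        refine ⟨hri, ?_⟩
        obtain rfl | ⟨h7, h8⟩ := h4 _ ha
        · exact hnew' _ hr0 hri
        · rw [Equiv.symm_apply_apply] at h7 h8
          -- The predecessor comes no earlier than the center of `r`, so it is not the first point
          -- and `scaled` applies.
          have hp0 : G.pred i ≠ 0 :=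
            fun h => hr0 (Fin.le_zero_iff.1 (h7.trans_eq h))
          have h9 := mul_le_mul_of_nonneg_left (hG.scaled i hi hp0) hγ.le
          have h10 := htri c (G.order (G.pred i)) (G.order i)
          rw [hcomm (G.order (G.pred i))] at h10
          have h11 : γ * (α * d (G.order i) (G.order (G.pred i))) =
              (1 + γ) * d (G.order i) (G.order (G.pred i)) := by rw [← hαγ]; ring
          linarith

lemma IsGreedy.isNetTree_tree (hG : G.IsGreedy d α β) (hα : 1 < α) (hβ : 1 ≤ β)
    (hcomm : ∀ x y, d x y = d y x)
    (htri : ∀ x y z, d x z ≤ d x y + d y z) :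
    G.IsNetTree d (β ^ 2 * (1 + 1 / (α - 1))) (1 / (α - 1)) G.tree ∧
      G.tree.center = G.order 0 ∧ ∀ x, x ∈ G.tree.points := by
  have h := foldl_induction (n := n) (fun k t =>
    G.IsNetTree d (β ^ 2 * (1 + 1 / (α - 1))) (1 / (α - 1)) t ∧
      t.center = G.order 0 ∧ ∀ x, x ∈ t.points ↔ (G.order.symm x : ℕ) ≤ k)
    (fun t i => t.splitLeaf (G.order (G.pred i.succ)) (G.order i.succ))
    (BallTree.leaf (G.order 0)) ?_ ?_
  · exact ⟨h.1, h.2.1, fun x => (h.2.2 x).2 (by omega)⟩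
  · refine ⟨trivial, rfl, fun x => ?_⟩
    simp [BallTree.points, ← Equiv.symm_apply_eq]
  · rintro i t ⟨h1, h2, h3⟩
    have hi : i.succ ≠ 0 := Fin.succ_ne_zero i
    refine ⟨h1.splitLeaf hG hα hβ hcomm htri hi fun x hx => ?_, by simpa using h2,
      fun x => ?_⟩
    · have := (h3 x).1 hx
      rw [Fin.lt_def, Fin.val_succ]
      omega
    · have hp : G.order (G.pred i.succ) ∈ t.points := by
        have := G.pred_lt i.succ hi
        rw [Fin.lt_def, Fin.val_succ] at this
        rw [h3, Equiv.symm_apply_apply]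
        omega
      rw [BallTree.points_splitLeaf, if_pos hp, Finset.mem_insert, h3, ← Equiv.symm_apply_eq,
        Fin.ext_iff, Fin.val_succ]
      omega

end PredPairing

/-! ### Separation of points inserted at a common scale. -/

lemma le_mul_dist_of_insDist {P : Type*} {m n : ℕ} {D : Fin m → MetricSpace P}
    {G : PredPairing P n} {α β B : ℝ}
    (hG : G.IsGreedy (prodDist D) α β) (hB : 0 ≤ B) (hβ : 0 ≤ β) {ρ : ℝ}
    {x y : P}
    (hx : G.order.symm x ≠ 0 → ∃ i, G.order.symm x ≤ i ∧ ρ ≤ B * G.insDist (prodDist D) i)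
    (hy : G.order.symm y ≠ 0 → ∃ i, G.order.symm y ≤ i ∧ ρ ≤ B * G.insDist (prodDist D) i)
    (hxy : x ≠ y) : ρ ≤ B * β * prodDist D x y := by
  -- Only the later point's witness is needed; being later, it is not the first point, for which no
  -- witness is required.
  wlog hlt : G.order.symm x < G.order.symm y generalizing x y
  · rw [prodDist_comm]
    exact this hy hx hxy.symm
      (lt_of_le_of_ne (not_lt.1 hlt) fun h => hxy (G.order.symm.injective h.symm))
  obtain ⟨i, hi, hρ⟩ := hy (Fin.ne_zero_of_lt hlt)
  have := mul_le_mul_of_nonneg_left (hG.insDist_le_mul_dist hβ hlt hi) hB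
  rw [Equiv.apply_symm_apply, Equiv.apply_symm_apply, prodDist_comm] at this
  linarith

/-! ### Counting the nodes that a query can process. -/

section Visited

variable {P : Type*} [DecidableEq P] {m n : ℕ}

/-- The centers of the right children of the nodes that a query may have to inspect. -/
noncomputable def visited (D : Fin m → MetricSpace P) (q : P) (r : Fin m → ℝ) (ε : ℝ) :
    BallTree P → Finset P
  | .leaf _ => ∅
  | .node c vL vR =>
    open Classical in
    (if (∃ i, ε * r i < (BallTree.node c vL vR).radius (prodDist D)) ∧
        ∀ i, (D i).dist q c ≤ r i + (BallTree.node c vL vR).radius (prodDist D)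
      then {vR.center} else ∅) ∪ (visited D q r ε vL ∪ visited D q r ε vR)

variable {D : Fin m → MetricSpace P} {q : P} {r : Fin m → ℝ} {ε : ℝ} {G : PredPairing P n}
  {B γ : ℝ}

/-- The center is passed on to left children, so it is never the center of a right child further
down. Thus distinct inner nodes have distinct right centers, and counting these counts nodes. -/
lemma visited_subset {v : BallTree P} (h : G.IsNetTree (prodDist D) B γ v) :
    visited D q r ε v ⊆ v.points.erase v.center := by
  induction v with
  | leaf c => simp [visited]
  | node c l s hl hs =>
    obtain ⟨h1, h2, h3, -, h5, h6⟩ := h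
    have hc : c ∈ l.points := h1 ▸ h5.center_mem
    have hcs : c ∉ s.points := Finset.disjoint_left.1 h2 hc
    intro x hx
    simp only [visited, Finset.mem_union] at hx
    simp only [BallTree.points, BallTree.center, Finset.mem_erase, Finset.mem_union]
    have aux : x ∈ s.points → x ≠ c ∧ (x ∈ l.points ∨ x ∈ s.points) := by
      intro hxs
      exact ⟨fun h => hcs (h ▸ hxs), Or.inr hxs⟩
    rcases hx with hx | hx | hx
    · split_ifs at hx
      · rw [Finset.mem_singleton.1 hx] at aux ⊢
        exact aux h6.center_mem
      · simp at hx
    · have := Finset.mem_erase.1 (hl h5 hx)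
      exact ⟨h1 ▸ this.1, Or.inl this.2⟩
    · exact aux (Finset.mem_of_mem_erase (hs h6 hx))

/-- Processing a node releases exactly one unit of potential; the rest passes to its children. -/
lemma card_visited_node {c : P} {l s : BallTree P}
    (h : G.IsNetTree (prodDist D) B γ (.node c l s))
    (hloop : ∃ i, ε * r i < (BallTree.node c l s).radius (prodDist D))
    (hnear : ∀ i, (D i).dist q c ≤ r i + (BallTree.node c l s).radius (prodDist D)) :
    1 + ((visited D q r ε l).card + (visited D q r ε s).card) =
      (visited D q r ε (.node c l s)).card := by
  obtain ⟨h1, h2, h3, -, h5, h6⟩ := h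
  have hl := visited_subset (q := q) (r := r) (ε := ε) h5
  have hs := visited_subset (q := q) (r := r) (ε := ε) h6
  rw [visited, if_pos ⟨hloop, hnear⟩, Finset.card_union_of_disjoint, Finset.card_singleton,
    Finset.card_union_of_disjoint]
  · exact h2.mono (hl.trans (Finset.erase_subset _ _)) (hs.trans (Finset.erase_subset _ _))
  · rw [Finset.disjoint_singleton_left, Finset.mem_union, not_or]
    exact ⟨fun h => Finset.disjoint_right.1 h2 h6.center_mem (Finset.mem_of_mem_erase (hl h)),
      fun h => Finset.notMem_erase _ _ (hs h)⟩

/-- The scale is the radius of the node whose right child has center `x`. The last two clauses place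
it between the smallest and the largest distance. -/
lemma exists_scale_of_mem_visited (hB : 0 ≤ B) (hγ : 0 ≤ γ) {v : BallTree P}
    (h : G.IsNetTree (prodDist D) B γ v) {x : P} (hx : x ∈ visited D q r ε v) :
    ∃ ρ, (∃ i, ε * r i < ρ) ∧ (∀ i, (D i).dist q x ≤ r i + 2 * ρ) ∧
      ρ ≤ B * G.insDist (prodDist D) (G.order.symm x) ∧
      (∃ y z, y ≠ z ∧ prodDist D y z ≤ ρ) ∧ ∃ y z, ρ ≤ prodDist D y z := by
  induction v with
  | leaf c => simp [visited] at hx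
  | node c l s hl hs =>
    obtain ⟨h1, h2, h3, h4, h5, h6⟩ := h
    simp only [visited, Finset.mem_union] at hx
    rcases hx with hx | hx | hx
    · split_ifs at hx with hrel
      swap
      · simp at hx
      obtain rfl := Finset.mem_singleton.1 hx
      have hmem : s.center ∈ (BallTree.node c l s).points :=
        Finset.mem_union_right _ h6.center_mem
      have hc : c ≠ s.center := fun h => h3.ne (congrArg _ h)
      have hrad : prodDist D c s.center ≤ (BallTree.node c l s).radius (prodDist D) :=
        BallTree.dist_le_radius (prodDist D) (.node c l s) hmem
      have hins : 0 ≤ B * G.insDist (prodDist D) (G.order.symm s.center) :=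
        mul_nonneg hB (G.insDist_nonneg (prodDist_nonneg D) _)
      refine ⟨_, hrel.1, fun i => ?_, ?_, ⟨_, _, hc, hrad⟩, ?_⟩
      · have := (D i).dist_triangle q c s.center
        have := hrel.2 i
        have := dist_le_prodDist D i c s.center
        linarith
      · refine BallTree.radius_le _ _ hins fun y hy => ?_
        obtain rfl | ⟨-, h7⟩ := h4 y hy
        · exact (prodDist_self D _).trans_le hins
        · have := mul_nonneg hγ (prodDist_nonneg D y (G.order (G.pred (G.order.symm y))))
          change prodDist D c y ≤ _
          linarith
      · have : Nonempty {x // x ∈ (BallTree.node c l s).points} := ⟨⟨_, hmem⟩⟩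
        obtain ⟨y, hy⟩ := exists_eq_ciSup_of_finite
          (f := fun x : {x // x ∈ (BallTree.node c l s).points} => prodDist D c x)
        exact ⟨c, y, hy.ge⟩
    · exact hl h5 hx
    · exact hs h6 hx

lemma dist_le_spread_aux [Finite P] [Nontrivial P] (hm : 0 < m) :
    ∃ a, 0 < a ∧ (∀ x y, x ≠ y → a ≤ prodDist D x y) ∧
      ∀ x y, prodDist D x y ≤ spread (prodDist D) * a := by
  obtain ⟨u, v, huv⟩ := exists_pair_ne P
  have : Nonempty {z : P × P // z.1 ≠ z.2} := ⟨⟨(u, v), huv⟩⟩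
  set f : {z : P × P // z.1 ≠ z.2} → ℝ := fun z => prodDist D z.1.1 z.1.2 with hf
  obtain ⟨z, hz⟩ := exists_eq_ciInf_of_finite (f := f)
  have ha : 0 < ⨅ z, f z := hz ▸ prodDist_pos D hm z.2
  have hs : spread (prodDist D) * (⨅ z, f z) = ⨆ z, f z := div_mul_cancel₀ _ ha.ne'
  refine ⟨⨅ z, f z, ha, fun x y h => ?_, fun x y => ?_⟩
  · exact ciInf_le (Set.finite_range f).bddBelow ⟨(x, y), h⟩
  · rw [hs]
    have hle := fun z => le_ciSup (f := f) (Set.finite_range f).bddAbove z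
    by_cases h : x = y
    · rw [h, prodDist_self]
      exact (prodDist_nonneg D u v).trans (hle ⟨(u, v), huv⟩)
    · exact hle ⟨(x, y), h⟩

lemma one_le_spread [Finite P] [Nontrivial P] (hm : 0 < m) : 1 ≤ spread (prodDist D) := by
  obtain ⟨a, ha, h1, h2⟩ := dist_le_spread_aux (D := D) hm
  obtain ⟨u, v, huv⟩ := exists_pair_ne P
  have := (h1 u v huv).trans (h2 u v)
  by_contra h
  nlinarith

variable {α β : ℝ}

/-- Sort the centers by the dyadic range of their scale relative to the smallest distance `a`.
Scales lie in `[a, Δ * a]`, and within one range the packing hypothesis applies. -/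
lemma card_visited_le [Finite P] [Nontrivial P] (hm : 0 < m)
    (hG : G.IsGreedy (prodDist D) α β) (hB : 0 ≤ B) (hγ : 0 ≤ γ) (hβ : 0 ≤ β)
    {N : ℕ} (hN : ∀ (S : Finset P) (ρ : ℝ), (∃ i, ε * r i < ρ) →
      (∀ x ∈ S, ∀ i, (D i).dist q x ≤ r i + 2 * ρ) →
      (∀ x ∈ S, ∀ y ∈ S, x ≠ y → ρ ≤ 2 * B * β * prodDist D x y) → S.card ≤ N)
    {v : BallTree P} (h : G.IsNetTree (prodDist D) B γ v) :
    ((visited D q r ε v).card : ℝ) ≤ N * (1 + Real.logb 2 (spread (prodDist D))) := by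
  obtain ⟨a, ha, hmin, hmax⟩ := dist_le_spread_aux (D := D) hm
  have hex : ∀ x, ∃ ρ, x ∈ visited D q r ε v → (∃ i, ε * r i < ρ) ∧
      (∀ i, (D i).dist q x ≤ r i + 2 * ρ) ∧
      ρ ≤ B * G.insDist (prodDist D) (G.order.symm x) ∧
      a ≤ ρ ∧ ρ ≤ spread (prodDist D) * a := by
    intro x
    by_cases hx : x ∈ visited D q r ε v
    · obtain ⟨ρ, h1, h2, h3, ⟨y, z, hyz, h4⟩, y', z', h5⟩ := exists_scale_of_mem_visited hB hγ h hx
      exact ⟨ρ, fun _ => ⟨h1, h2, h3, (hmin y z hyz).trans h4, h5.trans (hmax y' z')⟩⟩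
    · exact ⟨0, fun h => absurd h hx⟩
  choose ρ hρ using hex
  have hΔ : 1 ≤ spread (prodDist D) := one_le_spread hm
  have hlogΔ : 0 ≤ Real.logb 2 (spread (prodDist D)) := Real.logb_nonneg one_lt_two hΔ
  set lev : P → ℕ := fun x => ⌊Real.logb 2 (ρ x / a)⌋₊ with hlev
  set L := ⌊Real.logb 2 (spread (prodDist D))⌋₊ with hL
  have hmaps : ∀ x ∈ visited D q r ε v, lev x ∈ Finset.range (L + 1) := by
    intro x hx
    obtain ⟨-, -, -, h4, h5⟩ := hρ x hx
    rw [Finset.mem_range, Nat.lt_succ_iff]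
    have hpos : 0 < ρ x / a := div_pos (ha.trans_le h4) ha
    exact Nat.floor_le_floor
      (Real.logb_le_logb_of_le one_lt_two hpos ((div_le_iff₀ ha).2 h5))
  have hfib : ∀ j ∈ Finset.range (L + 1),
      ((visited D q r ε v).filter fun x => lev x = j).card ≤ N := by
    intro j _
    have hbd : ∀ x ∈ (visited D q r ε v).filter (fun x => lev x = j),
        2 ^ j * a ≤ ρ x ∧ ρ x < 2 * (2 ^ j * a) := by
      intro x hx
      obtain ⟨hx, hj⟩ := Finset.mem_filter.1 hx
      obtain ⟨-, -, -, h4, -⟩ := hρ x hx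
      have hpos : 0 < ρ x / a := div_pos (ha.trans_le h4) ha
      have h0 : 0 ≤ Real.logb 2 (ρ x / a) :=
        Real.logb_nonneg one_lt_two ((one_le_div ha).2 h4)
      obtain ⟨h6, h7⟩ := (Nat.floor_eq_iff h0).1 hj
      rw [Real.le_logb_iff_rpow_le one_lt_two hpos, Real.rpow_natCast, le_div_iff₀ ha] at h6
      rw [Real.logb_lt_iff_lt_rpow one_lt_two hpos, div_lt_iff₀ ha] at h7
      refine ⟨h6, h7.trans_eq ?_⟩
      rw [← Nat.cast_succ, Real.rpow_natCast, pow_succ]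
      ring
    obtain hemp | ⟨x₀, hx₀⟩ :=
      ((visited D q r ε v).filter fun x => lev x = j).eq_empty_or_nonempty
    · rw [hemp]
      simp
    -- The upper end of the range serves as common scale, so that proximity to `q` holds for all its
    -- centers; the separation is known at the lower end, which uses the factor `2` in `2 * B * β`.
    refine hN _ (2 * (2 ^ j * a)) ?_ (fun x hx i => ?_) fun x hx y hy hxy => ?_
    · obtain ⟨i, hi⟩ := (hρ x₀ (Finset.mem_filter.1 hx₀).1).1
      exact ⟨i, hi.trans (hbd _ hx₀).2⟩
    · have := (hρ x (Finset.mem_filter.1 hx).1).2.1 i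
      linarith [(hbd x hx).2]
    · have := le_mul_dist_of_insDist (ρ := 2 ^ j * a) hG hB hβ (x := x) (y := y)
        (fun _ => ⟨_, le_rfl, (hbd x hx).1.trans (hρ x (Finset.mem_filter.1 hx).1).2.2.1⟩)
        (fun _ => ⟨_, le_rfl, (hbd y hy).1.trans (hρ y (Finset.mem_filter.1 hy).1).2.2.1⟩) hxy
      linarith
  have hcard : (visited D q r ε v).card ≤ N * (L + 1) := by
    rw [Finset.card_eq_sum_card_fiberwise hmaps]
    exact (Finset.sum_le_card_nsmul _ _ _ hfib).trans_eq (by simp [mul_comm])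
  calc ((visited D q r ε v).card : ℝ) ≤ N * (L + 1) := by exact_mod_cast hcard
    _ ≤ _ := by
      have := Nat.floor_le hlogΔ
      refine mul_le_mul_of_nonneg_left ?_ (Nat.cast_nonneg _)
      linarith

end Visited


/-! ### Amortized analysis of the query. -/

section Run

variable {P : Type*} [DecidableEq P] {m n : ℕ}

/-- The invariant of a query, with the number of rounds still to come as a potential. -/
structure QueryInv (D : Fin m → MetricSpace P) (q : P) (r : Fin m → ℝ) (ε : ℝ)
    (G : PredPairing P n) (B γ : ℝ) (K W : ℕ) (H : Multiset (BallTree P)) (out : Finset P)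
    (t : ℕ) : Prop where
  net : ∀ v ∈ H, G.IsNetTree (prodDist D) B γ v
  near : ∀ v ∈ H, ∀ i, (D i).dist q v.center ≤ r i + v.radius (prodDist D)
  birth : ∀ v ∈ H, G.order.symm v.center ≠ 0 → ∃ i, G.order.symm v.center ≤ i ∧
    ∀ u ∈ H, ∀ x ∈ u.points, ∀ y ∈ u.points,
      prodDist D x y ≤ 2 * B * G.insDist (prodDist D) i
  nodup : (out.val + H.bind fun v => v.points.val).Nodup
  time : t + K * (H.map fun v => (visited D q r ε v).card).sum ≤ 1 + K * W + 2 * out.card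

variable {D : Fin m → MetricSpace P} {q : P} {r : Fin m → ℝ} {ε : ℝ} {G : PredPairing P n}
  {B γ α β : ℝ} {K W : ℕ} {H : Multiset (BallTree P)} {out : Finset P} {t : ℕ}

lemma radius_leaf (c : P) : (BallTree.leaf c).radius (prodDist D) = 0 := by
  refine le_antisymm (BallTree.radius_le _ _ le_rfl fun x hx => ?_)
    (Real.iSup_nonneg fun _ => prodDist_nonneg D _ _)
  rw [Finset.mem_singleton.1 hx]
  exact (prodDist_self D c).le

lemma mem_keep {u v : BallTree P} (h : u ∈ keep D q r v) :
    u = v ∧ ∀ i, (D i).dist q v.center ≤ r i + v.radius (prodDist D) := by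
  unfold keep at h
  split_ifs at h with h1
  · exact ⟨Multiset.mem_singleton.1 h, h1⟩
  · simp at h

lemma keep_le (v : BallTree P) : keep D q r v ≤ {v} := by
  unfold keep
  split_ifs
  · exact le_rfl
  · exact Multiset.zero_le _

lemma map_center_le_bind_points (hnet : ∀ v ∈ H, G.IsNetTree (prodDist D) B γ v) :
    H.map BallTree.center ≤ H.bind fun v => v.points.val := by
  induction H using Multiset.induction with
  | empty => simp
  | cons v H ih =>
    rw [Multiset.map_cons, Multiset.cons_bind, ← Multiset.singleton_add]
    refine add_le_add (Multiset.singleton_le.2 ?_)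
      (ih fun u hu => hnet u (Multiset.mem_cons_of_mem hu))
    exact (hnet v (Multiset.mem_cons_self v H)).center_mem

lemma sum_numNodes_le (hnet : ∀ v ∈ H, G.IsNetTree (prodDist D) B γ v) :
    (H.map BallTree.numNodes).sum ≤ 2 * (H.bind fun v => v.points.val).card := by
  induction H using Multiset.induction with
  | empty => simp
  | cons v H ih =>
    have := ih fun u hu => hnet u (Multiset.mem_cons_of_mem hu)
    have := (hnet v (Multiset.mem_cons_self v H)).numNodes_succ
    rw [Multiset.map_cons, Multiset.sum_cons, Multiset.cons_bind, Multiset.card_add,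
      Finset.card_val]
    omega

/-- At the scale of the maximum radius, the heap centers are near `q` by `near` and separated by
`birth`. They are distinct because the nodes store disjoint point sets. -/
lemma QueryInv.card_heap_le (h : QueryInv D q r ε G B γ K W H out t)
    (hG : G.IsGreedy (prodDist D) α β) (hB : 0 ≤ B) (hβ : 0 ≤ β) (hε : 0 ≤ ε)
    (hr : ∀ i, 0 ≤ r i)
    {N : ℕ} (hN : ∀ (S : Finset P) (ρ : ℝ), (∃ i, ε * r i < ρ) →
      (∀ x ∈ S, ∀ i, (D i).dist q x ≤ r i + 2 * ρ) →
      (∀ x ∈ S, ∀ y ∈ S, x ≠ y → ρ ≤ 2 * B * β * prodDist D x y) → S.card ≤ N)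
    {v : BallTree P} (hv : v ∈ H)
    (hmax : ∀ u ∈ H, u.radius (prodDist D) ≤ v.radius (prodDist D))
    (hloop : ∃ i, ε * r i < v.radius (prodDist D)) : H.card ≤ N := by
  have hnd : (H.map BallTree.center).Nodup :=
    Multiset.nodup_of_le ((map_center_le_bind_points h.net).trans (Multiset.le_add_left _ _))
      h.nodup
  have hρ : 0 < v.radius (prodDist D) := by
    obtain ⟨i, hi⟩ := hloop
    exact (mul_nonneg hε (hr i)).trans_lt hi
  have hbirth : ∀ u ∈ H, G.order.symm u.center ≠ 0 → ∃ i, G.order.symm u.center ≤ i ∧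
      v.radius (prodDist D) ≤ 2 * B * G.insDist (prodDist D) i := by
    intro u hu h0
    obtain ⟨i, hi, hd⟩ := h.birth u hu h0
    refine ⟨i, hi, BallTree.radius_le _ _ ?_ fun x hx => hd v hv _ (h.net v hv).center_mem x hx⟩
    exact mul_nonneg (by linarith) (G.insDist_nonneg (prodDist_nonneg D) _)
  have := hN (H.map BallTree.center).toFinset (v.radius (prodDist D)) hloop ?_ ?_
  · rwa [Multiset.toFinset_card_of_nodup hnd, Multiset.card_map] at this
  · intro x hx i
    obtain ⟨u, hu, rfl⟩ := Multiset.mem_map.1 (Multiset.mem_toFinset.1 hx)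
    linarith [h.near u hu i, hmax u hu]
  · intro x hx y hy hxy
    obtain ⟨u, hu, rfl⟩ := Multiset.mem_map.1 (Multiset.mem_toFinset.1 hx)
    obtain ⟨w, hw, rfl⟩ := Multiset.mem_map.1 (Multiset.mem_toFinset.1 hy)
    exact le_mul_dist_of_insDist hG (by linarith) hβ (hbirth u hu) (hbirth w hw) hxy

/-- The released potential `K` pays for the round, and the enlarged output pays for reporting the
points. -/
lemma QueryInv.accept {v : BallTree P} {N : ℕ}
    (h : QueryInv D q r ε G B γ K W (v ::ₘ H) out t)
    (hK : 7 * m + 3 * N + 6 ≤ K) (hcard : H.card + 1 ≤ N)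
    (hvis : 1 ≤ (visited D q r ε v).card) :
    QueryInv D q r ε G B γ K W H (out ∪ v.points)
      (t + ((m + 1) + heapTime (H.card + 1) + 2 * m + v.numNodes)) where
  net u hu := h.net u (Multiset.mem_cons_of_mem hu)
  near u hu := h.near u (Multiset.mem_cons_of_mem hu)
  birth u hu h0 := by
    obtain ⟨i, hi, hd⟩ := h.birth u (Multiset.mem_cons_of_mem hu) h0
    exact ⟨i, hi, fun w hw => hd w (Multiset.mem_cons_of_mem hw)⟩
  nodup := by
    have hnd := h.nodup
    rw [Multiset.cons_bind, ← add_assoc] at hnd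
    have hdisj : Disjoint out v.points :=
      Finset.disjoint_val.1 (Multiset.nodup_add.1 (Multiset.nodup_add.1 hnd).1).2.2
    rwa [← Finset.disjUnion_eq_union _ _ hdisj, Finset.disjUnion_val]
  time := by
    have hnd := h.nodup
    rw [Multiset.cons_bind, ← add_assoc] at hnd
    have hdisj : Disjoint out v.points :=
      Finset.disjoint_val.1 (Multiset.nodup_add.1 (Multiset.nodup_add.1 hnd).1).2.2
    have h1 := h.time
    have h2 := (h.net v (Multiset.mem_cons_self v H)).numNodes_succ
    have h3 : heapTime (H.card + 1) ≤ 1 + (H.card + 1) :=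
      Nat.add_le_add_left (Nat.log_le_self _ _) _
    rw [Multiset.map_cons, Multiset.sum_cons, Nat.mul_add] at h1
    have h4 := Nat.le_mul_of_pos_right K hvis
    rw [Finset.card_union_of_disjoint hdisj]
    omega

lemma QueryInv.split {c : P} {vL vR : BallTree P} {N : ℕ} (hβ : 0 ≤ B) (hγ : 0 ≤ γ)
    (h : QueryInv D q r ε G B γ K W (.node c vL vR ::ₘ H) out t)
    (hmax : ∀ u ∈ H, u.radius (prodDist D) ≤ (BallTree.node c vL vR).radius (prodDist D))
    (hK : 7 * m + 3 * N + 6 ≤ K) (hcard : H.card + 1 ≤ N)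
    (hvis : 1 + ((visited D q r ε vL).card + (visited D q r ε vR).card) =
      (visited D q r ε (.node c vL vR)).card) :
    QueryInv D q r ε G B γ K W (keep D q r vR + keep D q r vL + H) out
      (t + ((m + 1) + heapTime (H.card + 1) + 2 * m +
            (2 * m + 2 * m + 2 * heapTime (H.card + 2)))) := by
  have hmem : ∀ u ∈ keep D q r vR + keep D q r vL + H,
      ((u = vL ∨ u = vR) ∧ ∀ i, (D i).dist q u.center ≤ r i + u.radius (prodDist D)) ∨ u ∈ H := by
    intro u hu
    rw [Multiset.mem_add, Multiset.mem_add] at hu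
    rcases hu with (hu | hu) | hu
    · obtain ⟨rfl, h⟩ := mem_keep hu
      exact Or.inl ⟨Or.inr rfl, h⟩
    · obtain ⟨rfl, h⟩ := mem_keep hu
      exact Or.inl ⟨Or.inl rfl, h⟩
    · exact Or.inr hu
  have hle : keep D q r vR + keep D q r vL + H ≤ {vR} + {vL} + H :=
    add_le_add (add_le_add (keep_le _) (keep_le _)) le_rfl
  have hnode := h.net _ (Multiset.mem_cons_self _ H)
  obtain ⟨h1, h2, h3, h4, h5, h6⟩ := id hnode
  have hsub : ∀ u, u = vL ∨ u = vR → u.points ⊆ (BallTree.node c vL vR).points := by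
    rintro u (rfl | rfl)
    · exact Finset.subset_union_left
    · exact Finset.subset_union_right
  -- A right child has a new center and may have a larger radius than its parent, so the invariant
  -- controls diameters: these never grow on passing to children.
  have hdiam : ∀ u ∈ keep D q r vR + keep D q r vL + H, ∀ x ∈ u.points, ∀ y ∈ u.points,
      prodDist D x y ≤ 2 * (BallTree.node c vL vR).radius (prodDist D) := by
    have aux : ∀ u : BallTree P, ∀ x ∈ u.points, ∀ y ∈ u.points,
        prodDist D x y ≤ 2 * u.radius (prodDist D) := by
      intro u x hx y hy
      have := prodDist_triangle D x u.center y
      have := u.dist_le_radius (prodDist D) hx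
      have := u.dist_le_radius (prodDist D) hy
      rw [prodDist_comm D x u.center] at *
      linarith
    intro u hu x hx y hy
    rcases hmem u hu with ⟨hu, -⟩ | hu
    · exact aux _ x (hsub u hu hx) y (hsub u hu hy)
    · linarith [aux u x hx y hy, hmax u hu]
  have hrad : (BallTree.node c vL vR).radius (prodDist D) ≤
      B * G.insDist (prodDist D) (G.order.symm vR.center) := by
    have hins : 0 ≤ B * G.insDist (prodDist D) (G.order.symm vR.center) :=
      mul_nonneg hβ (G.insDist_nonneg (prodDist_nonneg D) _)
    refine BallTree.radius_le _ _ hins fun y hy => ?_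
    obtain rfl | ⟨-, h7⟩ := h4 y hy
    · exact (prodDist_self D _).trans_le hins
    · have := mul_nonneg hγ (prodDist_nonneg D y (G.order (G.pred (G.order.symm y))))
      change prodDist D c y ≤ _
      linarith
  refine ⟨fun u hu => ?_, fun u hu => ?_, fun u hu h0 => ?_, ?_, ?_⟩
  · rcases hmem u hu with ⟨rfl | rfl, -⟩ | hu
    · exact h5
    · exact h6
    · exact h.net u (Multiset.mem_cons_of_mem hu)
  · rcases hmem u hu with ⟨-, hu⟩ | hu
    · exact hu
    · exact h.near u (Multiset.mem_cons_of_mem hu)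
  · rcases hmem u hu with ⟨hu, -⟩ | hu
    -- A new child takes the index of the right center as witness: the split node had maximum
    -- radius, which `hrad` bounds by this insertion distance. Older nodes keep their witness.
    · refine ⟨G.order.symm vR.center, ?_, fun w hw x hx y hy => ?_⟩
      · rcases hu with rfl | rfl
        · exact h1 ▸ h3.le
        · exact le_rfl
      · linarith [hdiam w hw x hx y hy]
    · obtain ⟨i, hi, hd⟩ := h.birth u (Multiset.mem_cons_of_mem hu) h0
      refine ⟨i, hi, fun w hw x hx y hy => ?_⟩
      rcases hmem w hw with ⟨hw, -⟩ | hw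
      · exact hd _ (Multiset.mem_cons_self _ H) x (hsub w hw hx) y (hsub w hw hy)
      · exact hd w (Multiset.mem_cons_of_mem hw) x hx y hy
  · refine Multiset.nodup_of_le (add_le_add le_rfl
      ((Multiset.le_iff_exists_add.1 hle).elim fun Z hZ => ?_)) h.nodup
    have hval : (BallTree.node c vL vR).points.val = vR.points.val + vL.points.val := by
      rw [add_comm, ← Finset.disjUnion_val vL.points vR.points h2, Finset.disjUnion_eq_union]
      rfl
    have : (({vR} + {vL} + H).bind fun v : BallTree P => v.points.val) =
        (BallTree.node c vL vR ::ₘ H).bind fun v => v.points.val := by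
      simp only [Multiset.add_bind, Multiset.singleton_bind, Multiset.cons_bind, hval]
    rw [← this, hZ, Multiset.add_bind _ Z]
    exact Multiset.le_add_right _ _
  · have ht := h.time
    -- Bounding the logarithm by the heap size is enough. With `H.card + 1 ≤ N` the round costs at
    -- most `7 * m + 3 * N + 6`.
    have h7 : heapTime (H.card + 1) ≤ 1 + (H.card + 1) :=
      Nat.add_le_add_left (Nat.log_le_self _ _) _
    have h8 : heapTime (H.card + 2) ≤ 1 + (H.card + 2) :=
      Nat.add_le_add_left (Nat.log_le_self _ _) _
    have hsum : ((keep D q r vR + keep D q r vL + H).map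
        fun v => (visited D q r ε v).card).sum ≤
        (({vR} + {vL} + H).map fun v => (visited D q r ε v).card).sum := by
      obtain ⟨Z, hZ⟩ := Multiset.le_iff_exists_add.1 hle
      rw [hZ, Multiset.map_add _ _ Z, Multiset.sum_add]
      exact Nat.le_add_right _ _
    rw [Multiset.map_add, Multiset.sum_add, Multiset.map_add _ ({vR} + {vL}), Multiset.sum_add,
      Multiset.map_add _ {vR}, Multiset.sum_add, Multiset.map_singleton, Multiset.map_singleton,
      Multiset.sum_singleton, Multiset.sum_singleton, ← Multiset.sum_add, ← Multiset.map_add]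
      at hsum
    rw [Multiset.map_cons, Multiset.sum_cons, ← hvis] at ht
    have := Nat.mul_le_mul_left K hsum
    simp only [Nat.mul_add, Nat.mul_one] at this ht
    omega

lemma QueryInv.finish (h : QueryInv D q r ε G B γ K W H out t) :
    t + ((m + 1) + (H.map BallTree.numNodes).sum) ≤
      2 + m + K * W + 2 * (out ∪ (H.map BallTree.points).sup).card := by
  have h1 := h.time
  have h2 := sum_numNodes_le h.net
  have h3 : out.card + (H.bind fun v => v.points.val).card ≤
      (out ∪ (H.map BallTree.points).sup).card := by
    rw [← Finset.card_val out, ← Multiset.card_add, ← Multiset.toFinset_card_of_nodup h.nodup]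
    refine Finset.card_le_card fun x hx => ?_
    rw [Multiset.mem_toFinset, Multiset.mem_add, Multiset.mem_bind] at hx
    rw [Finset.mem_union]
    refine hx.imp id ?_
    rintro ⟨v, hv, hx⟩
    exact (Multiset.le_sup (Multiset.mem_map_of_mem _ hv) : v.points ≤ _) hx
  have h4 := Nat.zero_le (K * (H.map fun v => (visited D q r ε v).card).sum)
  omega

/-- Leaves have radius zero, so the loop condition excludes them and every extracted node is an
inner, counted one. The total number of tree nodes below the heap decreases in each round, which
gives termination. -/
lemma QueryInv.step {N : ℕ} (h : QueryInv D q r ε G B γ K W H out t)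
    (hG : G.IsGreedy (prodDist D) α β) (hB : 0 ≤ B) (hγ : 0 ≤ γ) (hβ : 0 ≤ β) (hε : 0 ≤ ε)
    (hr : ∀ i, 0 ≤ r i)
    (hN : ∀ (S : Finset P) (ρ : ℝ), (∃ i, ε * r i < ρ) →
      (∀ x ∈ S, ∀ i, (D i).dist q x ≤ r i + 2 * ρ) →
      (∀ x ∈ S, ∀ y ∈ S, x ≠ y → ρ ≤ 2 * B * β * prodDist D x y) → S.card ≤ N)
    (hK : 7 * m + 3 * N + 6 ≤ K) {c : Config P} (hc : Step D q r ε (.running H out t) c) :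
    (∃ H' out' t', c = .running H' out' t' ∧ QueryInv D q r ε G B γ K W H' out' t' ∧
      (H'.map BallTree.numNodes).sum < (H.map BallTree.numNodes).sum) ∨
    ∃ out' t', c = .done out' t' ∧ t' ≤ 2 + m + K * W + 2 * out'.card := by
  have hleaf : ∀ c : P, ¬ ∃ i, ε * r i < (BallTree.leaf c).radius (prodDist D) := by
    rintro c ⟨i, hi⟩
    rw [radius_leaf] at hi
    exact absurd (mul_nonneg hε (hr i)) (not_le.2 hi)
  have hnn : ∀ v : BallTree P, 0 < v.numNodes := by
    rintro (c | ⟨c, l, s⟩) <;> simp only [BallTree.numNodes] <;> omega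
  have hmax' : ∀ {H : Multiset (BallTree P)} {v : BallTree P},
      (∀ u ∈ H, u.radius (prodDist D) ≤ v.radius (prodDist D)) →
      ∀ u ∈ v ::ₘ H, u.radius (prodDist D) ≤ v.radius (prodDist D) := by
    intro H v h u hu
    rcases Multiset.mem_cons.1 hu with rfl | hu
    · exact le_rfl
    · exact h u hu
  cases hc with
  | accept H out t v hmax hloop hin =>
    have hv := Multiset.mem_cons_self v H
    have hcard := h.card_heap_le hG hB hβ hε hr hN hv (hmax' hmax) hloop
    rw [Multiset.card_cons] at hcard
    refine Or.inl ⟨_, _, _, rfl, h.accept hK hcard ?_, ?_⟩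
    · cases v with
      | leaf c => exact absurd hloop (hleaf c)
      | node c l s =>
        have := card_visited_node (h.net _ hv) hloop (h.near _ hv)
        omega
    · rw [Multiset.map_cons, Multiset.sum_cons]
      exact Nat.lt_add_of_pos_left (hnn v)
  | discard H out t c hmax hloop hin => exact absurd hloop (hleaf c)
  | split H out t c vL vR hmax hloop hin =>
    have hv := Multiset.mem_cons_self (BallTree.node c vL vR) H
    have hcard := h.card_heap_le hG hB hβ hε hr hN hv (hmax' hmax) hloop
    rw [Multiset.card_cons] at hcard
    refine Or.inl ⟨_, _, _, rfl, h.split hB hγ hmax hK hcard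
      (card_visited_node (h.net _ hv) hloop (h.near _ hv)), ?_⟩
    have hk : ∀ v : BallTree P, ((keep D q r v).map BallTree.numNodes).sum ≤ v.numNodes := by
      intro v
      unfold keep
      split_ifs <;> simp
    have h1 := hk vL
    have h2 := hk vR
    simp only [Multiset.map_add, Multiset.sum_add, Multiset.map_cons, Multiset.sum_cons,
      BallTree.numNodes]
    omega
  | finish H out t hloop => exact Or.inr ⟨_, _, rfl, h.finish⟩

lemma exists_step (H : Multiset (BallTree P)) (out : Finset P) (t : ℕ) :
    ∃ c, Step D q r ε (.running H out t) c := by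
  by_cases hloop : ∀ v ∈ H, ∀ i, v.radius (prodDist D) ≤ ε * r i
  · exact ⟨_, .finish H out t hloop⟩
  · push Not at hloop
    obtain ⟨v, hv, i, hi⟩ := hloop
    classical
    obtain ⟨w, hw, hmax⟩ := H.toFinset.exists_max_image
      (fun u => u.radius (prodDist D)) ⟨v, by simpa using hv⟩
    simp only [Multiset.mem_toFinset] at hw hmax
    obtain ⟨H, rfl⟩ := Multiset.exists_cons_of_mem hw
    have hloop : ∃ i, ε * r i < w.radius (prodDist D) := ⟨i, hi.trans_le (hmax v hv)⟩
    have hmax' := fun u hu => hmax u (Multiset.mem_cons_of_mem hu)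
    by_cases hin : ∀ i, (D i).dist q w.center ≤ (1 + ε) * r i - w.radius (prodDist D)
    · exact ⟨_, .accept H out t w hmax' hloop hin⟩
    · cases w with
      | leaf c => exact ⟨_, .discard H out t c hmax' hloop hin⟩
      | node c l s => exact ⟨_, .split H out t c l s hmax' hloop hin⟩

lemma queryTakes_of_separated {N : ℕ} (hG : G.IsGreedy (prodDist D) α β)
    (hB : 0 ≤ B) (hγ : 0 ≤ γ) (hβ : 0 ≤ β) (hε : 0 ≤ ε) (hr : ∀ i, 0 ≤ r i)
    (hN : ∀ (S : Finset P) (ρ : ℝ), (∃ i, ε * r i < ρ) →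
      (∀ x ∈ S, ∀ i, (D i).dist q x ≤ r i + 2 * ρ) →
      (∀ x ∈ S, ∀ y ∈ S, x ≠ y → ρ ≤ 2 * B * β * prodDist D x y) → S.card ≤ N)
    {T : BallTree P} (hT : G.IsNetTree (prodDist D) B γ T) (hroot : T.center = G.order 0)
    (hq : q ∈ T.points) {b : Finset P → ℝ}
    (hb : ∀ out : Finset P, ((2 + m + (7 * m + 3 * N + 6) * (visited D q r ε T).card +
      2 * out.card : ℕ) : ℝ) ≤ b out) :
    QueryTakes D T q r ε b := by
  set K := 7 * m + 3 * N + 6 with hK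
  have hinit : QueryInv D q r ε G B γ K (visited D q r ε T).card {T} ∅ 1 := by
    refine ⟨?_, ?_, ?_, ?_, ?_⟩
    · intro v hv
      rwa [Multiset.mem_singleton.1 hv]
    -- Since `q` is stored below the root, the root passes the test that children undergo at
    -- insertion.
    · intro v hv i
      rw [Multiset.mem_singleton.1 hv]
      have h1 := T.dist_le_radius (prodDist D) hq
      have h2 := dist_le_prodDist D i T.center q
      rw [(D i).dist_comm T.center q] at h2
      linarith [hr i]
    · intro v hv h0
      rw [Multiset.mem_singleton.1 hv, hroot] at h0
      simp at h0
    · simpa using T.points.nodup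
    · simp
  have hdone : ∀ out t c, ¬ Step D q r ε (.done out t) c := by
    intro out t c h
    cases h
  constructor
  · have key : ∀ N' : ℕ, ∀ H out t, (H.map BallTree.numNodes).sum = N' →
        QueryInv D q r ε G B γ K (visited D q r ε T).card H out t →
        Acc (fun c' c => Step D q r ε c c') (.running H out t) := by
      intro N'
      induction N' using Nat.strong_induction_on with
      | _ N' ih =>
        intro H out t hsum hinv
        refine ⟨_, fun c hc => ?_⟩
        obtain ⟨H', out', t', rfl, hinv', hlt⟩ | ⟨out', t', rfl, -⟩ :=
          hinv.step hG hB hγ hβ hε hr hN hK.ge hc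
        · exact ih _ (hsum ▸ hlt) H' out' t' rfl hinv'
        · exact ⟨_, fun c hc => absurd hc (hdone _ _ _)⟩
    exact key _ _ _ _ rfl hinit
  · intro c hc hterm
    have hinv : (∃ H out t, c = .running H out t ∧
        QueryInv D q r ε G B γ K (visited D q r ε T).card H out t) ∨
        ∃ out t, c = .done out t ∧
          t ≤ 2 + m + K * (visited D q r ε T).card + 2 * out.card := by
      clear hterm
      induction hc with
      | refl => exact Or.inl ⟨_, _, _, rfl, hinit⟩
      | tail _ hstep ih =>
        obtain ⟨H, out, t, rfl, hinv⟩ | ⟨out, t, rfl, -⟩ := ih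
        · obtain ⟨H', out', t', rfl, hinv', -⟩ | h := hinv.step hG hB hγ hβ hε hr hN hK.ge hstep
          · exact Or.inl ⟨_, _, _, rfl, hinv'⟩
          · exact Or.inr h
        · exact absurd hstep (hdone _ _ _)
    obtain ⟨H, out, t, rfl, -⟩ | ⟨out, t, rfl, ht⟩ := hinv
    · obtain ⟨c', hc'⟩ := exists_step (D := D) (q := q) (r := r) (ε := ε) H out t
      exact absurd hc' (hterm c')
    · exact ⟨out, t, rfl, (Nat.cast_le.2 ht).trans (hb out)⟩

end Run


/-! ### Packing at the query's scale, and the final constants. -/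

lemma exists_pow_two_between {x : ℝ} (hx : 1 ≤ x) :
    ∃ k : ℕ, 1 ≤ k ∧ x < 2 ^ k ∧ (2 : ℝ) ^ k ≤ 2 * x := by
  obtain ⟨k, h1, h2⟩ := exists_nat_pow_near hx (one_lt_two (α := ℝ))
  exact ⟨k + 1, by omega, h2, by rw [pow_succ]; linarith⟩

/-- The packing bound at the scale at which a query operates. -/
lemma card_le_of_separated_of_query {P : Type*} [Finite P] {m : ℕ} (hm : 0 < m)
    (D : Fin m → MetricSpace P) {q : P} {r : Fin m → ℝ} (hr : ∀ i, 0 < r i) {ε : ℝ} (hε : 0 < ε)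
    {M : ℝ} (hM : 0 < M) {k : ℕ} (hk : 4 * M * (1 + (⨆ i, r i) / (⨅ i, r i) / ε) < 2 ^ k)
    (S : Finset P) (ρ : ℝ) (hρ : ∃ i, ε * r i < ρ)
    (hball : ∀ x ∈ S, ∀ i, (D i).dist q x ≤ r i + 2 * ρ)
    (hsep : ∀ x ∈ S, ∀ y ∈ S, x ≠ y → ρ ≤ M * prodDist D x y) :
    S.card ≤ (∏ i, doublingConst (D i).dist) ^ k := by
  have : Nonempty (Fin m) := ⟨⟨0, hm⟩⟩
  obtain ⟨i₀, hi₀⟩ := hρ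
  have hρ0 : 0 < ρ := (mul_pos hε (hr i₀)).trans hi₀
  obtain ⟨i₁, hi₁⟩ := exists_eq_ciInf_of_finite (f := r)
  have hinf : 0 < ⨅ i, r i := hi₁ ▸ hr i₁
  have hinfρ : ε * (⨅ i, r i) ≤ ρ :=
    (mul_le_mul_of_nonneg_left (ciInf_le (Set.finite_range r).bddBelow i₀) hε.le).trans hi₀.le
  set A := (⨆ i, r i) / (⨅ i, r i) with hA
  have hsup : ∀ i, r i ≤ A / ε * ρ := by
    intro i
    have h1 : r i ≤ ⨆ i, r i := le_ciSup (Set.finite_range r).bddAbove i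
    have h2 : (⨆ i, r i) = A * (⨅ i, r i) := (div_mul_cancel₀ _ hinf.ne').symm
    have hA0 : 0 ≤ A / ε := div_nonneg (div_nonneg ((hr i).le.trans h1) hinf.le) hε.le
    calc r i ≤ A * (⨅ i, r i) := h2 ▸ h1
      _ = A / ε * (ε * ⨅ i, r i) := by field_simp
      _ ≤ _ := mul_le_mul_of_nonneg_left hinfρ hA0
  have hA0 : 0 ≤ A / ε * ρ := (hr i₀).le.trans (hsup i₀)
  -- The ball radius is `r i + 2 * ρ ≤ (A / ε + 2) * ρ ≤ 2 * (1 + A / ε) * ρ`.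
  refine card_le_of_separated D hm q (2 * (1 + A / ε) * ρ) (ρ / M) k S
    (fun x hx i => ?_) (fun x hx y hy hxy => ?_) ?_
  · linarith [hball x hx i, hsup i]
  · rw [div_le_iff₀ hM, mul_comm]
    exact hsep x hx y hy hxy
  · rw [div_lt_div_iff₀ (by positivity) hM]
    have := mul_lt_mul_of_pos_right hk hρ0
    linarith

/-- As `δ ≥ 1`, the factor `32 = 2 ^ 5` is absorbed by `2 ^ (5 * δ)`, and `c ^ (2 * δ)` is a power
of two with exponent `2 * logb 2 c * δ`. -/
lemma two_rpow_bound {c y δ N : ℝ} (hc : 1 ≤ c) (hy : 1 ≤ y) (hδ : 1 ≤ δ) (hN0 : 0 ≤ N)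
    (hN : N ≤ (c * y) ^ δ) :
    32 * N ^ 2 ≤ 2 ^ ((5 + 2 * Real.logb 2 c) * δ) * y ^ ((5 + 2 * Real.logb 2 c) * δ) := by
  have hc0 : 0 < c := by linarith
  have hy0 : 0 < y := by linarith
  have hlog : 0 ≤ Real.logb 2 c := Real.logb_nonneg one_lt_two hc
  have h1 : N ^ 2 ≤ c ^ (2 * δ) * y ^ (2 * δ) := by
    calc N ^ 2 ≤ ((c * y) ^ δ) ^ 2 := pow_le_pow_left₀ hN0 hN 2
      _ = (c * y) ^ (2 * δ) := by
        rw [← Real.rpow_mul_natCast (by positivity), Nat.cast_ofNat, mul_comm δ]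
      _ = _ := Real.mul_rpow hc0.le hy0.le
  have h2 : (32 : ℝ) * c ^ (2 * δ) ≤ 2 ^ ((5 + 2 * Real.logb 2 c) * δ) := by
    have h3 : (2 : ℝ) ^ ((5 + 2 * Real.logb 2 c) * δ) = 2 ^ (5 * δ) * c ^ (2 * δ) := by
      rw [show (5 + 2 * Real.logb 2 c) * δ = 5 * δ + Real.logb 2 c * (2 * δ) by ring,
        Real.rpow_add two_pos, Real.rpow_mul two_pos.le (Real.logb 2 c),
        Real.rpow_logb two_pos (by norm_num) hc0]
    rw [h3]
    refine mul_le_mul_of_nonneg_right ?_ (by positivity)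
    calc (32 : ℝ) = 2 ^ (5 : ℝ) := by norm_num
      _ ≤ _ := Real.rpow_le_rpow_of_exponent_le one_le_two (by linarith)
  have h4 : y ^ (2 * δ) ≤ y ^ ((5 + 2 * Real.logb 2 c) * δ) :=
    Real.rpow_le_rpow_of_exponent_le hy (by nlinarith)
  calc 32 * N ^ 2 ≤ 32 * c ^ (2 * δ) * y ^ (2 * δ) := by linarith
    _ ≤ _ := mul_le_mul h2 h4 (by positivity) (by positivity)

end ProductRange

theorem mainTheorem2 (α β : ℝ) (hα : 1 < α) (hβ : 1 ≤ β) :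
    ∃ C : ℝ, 0 < C ∧
      ∀ (P : Type*) [DecidableEq P] [Finite P] [Nontrivial P] (m : ℕ) (_ : 0 < m)
        (D : Fin m → MetricSpace P)
        (n : ℕ) (G : ProductRange.PredPairing P n)
        (_ : G.IsGreedy (ProductRange.prodDist D) α β)
        (q : P) (r : Fin m → ℝ) (_ : ∀ i, 0 < r i) (ε : ℝ) (_ : 0 < ε)
        (δ A Δ : ℝ) (_ : δ = ∑ i, ProductRange.doublingDim (D i).dist)
        (_ : A = (⨆ i, r i) / (⨅ i, r i))
        (_ : Δ = ProductRange.spread (ProductRange.prodDist D)),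
        ProductRange.QueryTakes D G.tree q r ε fun out =>
          (2 : ℝ) ^ (C * δ) * (1 + A / ε) ^ (C * δ) * (1 + Real.logb 2 Δ) + C * (out.card : ℝ) := by
  have hγ : 0 < 1 / (α - 1) := one_div_pos.2 (by linarith)
  set γ := 1 / (α - 1) with hγdef
  have hB : 1 ≤ β ^ 2 * (1 + γ) :=
    one_le_mul_of_one_le_of_one_le (one_le_pow₀ hβ) (by linarith)
  set B := β ^ 2 * (1 + γ) with hBdef
  have hM : 1 ≤ B * β := one_le_mul_of_one_le_of_one_le hB hβ
  -- Chosen so that `2 ^ k ≤ 2 * (4 * (2 * B * β) * y) = c * y` below.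
  set c := 16 * (B * β) with hc
  have hlog : 0 ≤ Real.logb 2 c := Real.logb_nonneg one_lt_two (by linarith)
  refine ⟨5 + 2 * Real.logb 2 c, by linarith, ?_⟩
  rintro P _ _ _ m hm D n G hG q r hr ε hε δ A Δ hδ rfl rfl
  have : Nonempty (Fin m) := ⟨⟨0, hm⟩⟩
  obtain ⟨hT, hroot, hpts⟩ := hG.isNetTree_tree hα hβ (ProductRange.prodDist_comm D)
    (ProductRange.prodDist_triangle D)
  have hA : 0 ≤ (⨆ i, r i) / (⨅ i, r i) / ε :=
    div_nonneg (div_nonneg (Real.iSup_nonneg fun i => (hr i).le)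
      (Real.iInf_nonneg fun i => (hr i).le)) hε.le
  set y := 1 + (⨆ i, r i) / (⨅ i, r i) / ε with hy
  have hy1 : 1 ≤ y := by linarith
  have hxy : 1 ≤ 4 * (2 * B * β) * y := by nlinarith
  obtain ⟨k, hk1, hk2, hk3⟩ := ProductRange.exists_pow_two_between hxy
  set R := ∏ i, ProductRange.doublingConst (D i).dist with hR
  have hN := ProductRange.card_le_of_separated_of_query hm D (q := q) hr hε
    (by linarith : 0 < 2 * B * β) hk2
  have hRδ : (R : ℝ) = 2 ^ δ := hδ ▸ ProductRange.prod_doublingConst D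
  have hmR : 2 ^ m ≤ R := ProductRange.two_pow_le_prod_doublingConst D
  have hRN : R ≤ R ^ k := Nat.le_self_pow (by omega) R
  have hmN : m + 1 ≤ R ^ k := (Nat.succ_le_of_lt m.lt_two_pow_self).trans (hmR.trans hRN)
  have hδ1 : 1 ≤ δ := by
    have h1 : (2 : ℝ) ^ (1 : ℝ) ≤ 2 ^ δ := by
      rw [← hRδ, Real.rpow_one]
      exact_mod_cast (Nat.le_self_pow hm.ne' 2).trans hmR
    exact (Real.rpow_le_rpow_left_iff one_lt_two).1 h1
  set N := R ^ k with hNdef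
  -- Exchange the exponents: `N = (2 ^ δ) ^ k = (2 ^ k) ^ δ`.
  have hNle : (N : ℝ) ≤ (c * y) ^ δ := by
    rw [hNdef, Nat.cast_pow, hRδ, ← Real.rpow_mul_natCast two_pos.le, mul_comm δ,
      Real.rpow_natCast_mul two_pos.le]
    refine Real.rpow_le_rpow (by positivity) (hk3.trans_eq ?_) (by linarith)
    rw [hc]
    ring
  have hW := ProductRange.card_visited_le hm hG (by linarith) hγ.le (by linarith) hN hT
  refine ProductRange.queryTakes_of_separated hG (by linarith) hγ.le (by linarith) hε.le
    (fun i => (hr i).le) hN hT hroot (hpts q) fun out => ?_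
  have hbound := ProductRange.two_rpow_bound (by linarith) hy1 hδ1 (Nat.cast_nonneg N) hNle
  have hL : 1 ≤ 1 + Real.logb 2 (ProductRange.spread (ProductRange.prodDist D)) :=
    le_add_of_nonneg_right (Real.logb_nonneg one_lt_two (ProductRange.one_le_spread hm))
  set L := 1 + Real.logb 2 (ProductRange.spread (ProductRange.prodDist D)) with hLdef
  have hmN' : (m : ℝ) + 1 ≤ N := by exact_mod_cast hmN
  have hm' : (1 : ℝ) ≤ m := by exact_mod_cast hm
  -- From `m + 1 ≤ N`, one round costs at most `10 * N` and `2 + m ≤ 2 * N`, so `12 * N ^ 2 * L`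
  -- suffices; it is rounded up to a power of two.
  have h1 : (2 + m + (7 * m + 3 * N + 6) * (ProductRange.visited D q r ε G.tree).card : ℝ) ≤
      32 * N ^ 2 * L := by
    have hNL : (N : ℝ) ≤ N * L := le_mul_of_one_le_right (by linarith) hL
    calc _ ≤ 2 * (N * L) + 10 * N * (N * L) := by
          refine add_le_add (by linarith) (mul_le_mul (by linarith) hW (by positivity) (by linarith))
      _ ≤ 2 * N * (N * L) + 10 * N * (N * L) := by
          refine add_le_add (mul_le_mul_of_nonneg_right (by linarith) (by linarith)) le_rfl
      _ = 12 * N ^ 2 * L := by ring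
      _ ≤ 32 * N ^ 2 * L := by
          refine mul_le_mul_of_nonneg_right ?_ (by linarith)
          linarith [sq_nonneg (N : ℝ)]
  have h2 := mul_le_mul_of_nonneg_right hbound (by linarith : 0 ≤ L)
  have h3 : 2 * (out.card : ℝ) ≤ (5 + 2 * Real.logb 2 c) * out.card :=
    mul_le_mul_of_nonneg_right (by linarith) (Nat.cast_nonneg _)
  push_cast
  linarith
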